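/- **Theorem (Contraction Criteria for $C^1$-Smooth Vector Fields).** A *weak pairing* on $\mathbb{R}^n$ ($n\ge 1$) is a map $[\![\cdot,\cdot]\!]:\mathbb{R}^n\times\mathbb{R}^n\to\mathbb{R}$ such that for all $x,x_1,x_2,y\in\mathbb{R}^n$ and $\alpha\ge 0$: $[\![x_1+x_2,y]\!]\le[\![x_1,y]\!]+[\![x_2,y]\!]$; $[\![\alpha x,y]\!]=[\![x,\alpha y]\!]=\alpha[\![x,y]\!]$; $[\![-x,-y]\!]=[\![x,y]\!]$; $[\![x,x]\!]>0$ if $x\neq 0$; and $[\![x,y]\!]\le\sqrt{[\![x,x]\!]\,[\![y,y]\!]}$. It is *regular* if moreover $[\![-x,x]\!]=-[\![x,x]\!]$ for all $x$, and *compatible* with a norm $\|\cdot\|$ if $[\![x,x]\!]=\|x\|^2$ for all $x$. For a linear map $A$ let $\mu(A)=\lim_{h\to0+}\frac{\|\mathrm{Id}+hA\|-1}{h}$ be its logarithmic norm, where $\|\cdot\|$ is the induced operator norm. For a real function $g$ let $D^+g(t)=\limsup_{h\to0+}\frac{g(t+h)-g(t)}{h}$ be its upper right Dini derivative, with values in $[-\infty,\infty]$.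 Let $\|\cdot\|$ be any norm on $\mathbb{R}^n$ (equivalently, consider any nonzero finite-dimensional real normed space in place of $(\mathbb{R}^n,\|\cdot\|)$), with a compatible regular pairing $[\![\cdot,\cdot]\!]$, and consider the dynamics $\dot x=f(t,x)$. Let $C\subseteq\mathbb{R}^n$ be open and convex, such that $f(t,\cdot)$ is continuously differentiable on $C$ for every $t\ge0$ and $t\mapsto f(t,x)$ is continuous on $[0,\infty)$ for every $x\in C$. Let $C$ be forward invariant: every solution that starts in $C$ at a time $t_0\ge0$ remains in $C$ for as long as it exists. Write $Df(t,x)=\frac{\partial f}{\partial x}(t,x)$, and let $t\mapsto\phi(t,t_0,x_0)$ stand for a solution of $\dot x=f(t,x)$, $x(t_0)=x_0$; statements about $\phi$ are required for all solutions. Then, for every $b\in\mathbb{R}$, the following statements are equivalent: 1. $[\![f(t,x)-f(t,y),x-y]\!]\le b\|x-y\|^2$ for all $x,y\in C$, $t\ge0$; 2. $[\![Df(t,x)v,v]\!]\le b\|v\|^2$ for all $v\in\mathbb{R}^n$, $x\in C$, $t\ge0$; 3. $\mu(Df(t,x))\le b$ for all $x\in C$, $t\ge0$; 4. $D^+\|\phi(t,t_0,x_0)-\phi(t,t_0,y_0)\|\le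 b\,\|\phi(t,t_0,x_0)-\phi(t,t_0,y_0)\|$ for all $x_0,y_0\in C$ and $0\le t_0\le t<T$ for which both solutions exist on $[t_0,T)$, where $D^+$ is taken with respect to $t$; 5. $\|\phi(t,t_0,x_0)-\phi(t,t_0,y_0)\|\le e^{b(t-s)}\|\phi(s,t_0,x_0)-\phi(s,t_0,y_0)\|$ for all $x_0,y_0\in C$ and $0\le t_0\le s\le t$ for which both solutions exist on $[t_0,t]$. -/

import Mathlib

open Set Filter Topology

namespace ContractionTheory

/-- A real-valued binary operation `W x y = ⟦x, y⟧` on a real vector space is a *weak pairing*. -/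
structure IsWeakPairing {E : Type*} [AddCommGroup E] [Module ℝ E] (W : E → E → ℝ) : Prop where
  subadd : ∀ x₁ x₂ y, W (x₁ + x₂) y ≤ W x₁ y + W x₂ y
  smul_left : ∀ (a : ℝ) (x y : E), 0 ≤ a → W (a • x) y = a * W x y
  smul_right : ∀ (a : ℝ) (x y : E), 0 ≤ a → W x (a • y) = a * W x y
  neg_neg : ∀ x y, W (-x) (-y) = W x y
  pos : ∀ x, x ≠ 0 → 0 < W x x
  cauchy_schwarz : ∀ x y, W x y ≤ √(W x x * W y y)

/-- A *regular pairing* is a weak pairing with the straight angle property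
`⟦-x, x⟧ = -‖x‖²`, where `‖x‖² = ⟦x, x⟧` is the norm that the pairing induces. -/
structure IsRegularPairing {E : Type*} [AddCommGroup E] [Module ℝ E] (W : E → E → ℝ) : Prop
    extends IsWeakPairing W where
  straight_angle : ∀ x, W (-x) x = -W x x

/-- The pairing is compatible with the norm of the space: `⟦x, x⟧ = ‖x‖²`. -/
def IsCompatiblePairing {E : Type*} [NormedAddCommGroup E] (W : E → E → ℝ) : Prop :=
  ∀ x, W x x = ‖x‖ ^ 2

/-- The logarithmic norm `μ(A) = lim_{h → 0+} (‖Id + h A‖ - 1) / h` induced by the norm of `E`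
(`‖·‖` on operators is the induced operator norm).  The limit exists, see `tendsto_logNorm`. -/
noncomputable def logNorm {E : Type*} [NormedAddCommGroup E] [NormedSpace ℝ E]
    (A : E →L[ℝ] E) : ℝ :=
  limUnder (𝓝[>] (0 : ℝ)) fun h => (‖ContinuousLinearMap.id ℝ E + h • A‖ - 1) / h

/-- The limit that defines the logarithmic norm exists on every nonzero normed space. -/
theorem tendsto_logNorm {E : Type*} [NormedAddCommGroup E] [NormedSpace ℝ E] [Nontrivial E]
    (A : E →L[ℝ] E) :
    Tendsto (fun h : ℝ => (‖ContinuousLinearMap.id ℝ E + h • A‖ - 1) / h) (𝓝[>] 0)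
      (𝓝 (logNorm A)) := by
  have h1 : ‖ContinuousLinearMap.id ℝ E‖ = 1 := ContinuousLinearMap.norm_id
  have hmono : MonotoneOn (fun h : ℝ => (‖ContinuousLinearMap.id ℝ E + h • A‖ - 1) / h)
      (Ioi 0) := by
    intro h hh k hk hhk
    simp only [mem_Ioi] at hh hk
    have e : ContinuousLinearMap.id ℝ E + h • A = (1 - h / k) • ContinuousLinearMap.id ℝ E
        + (h / k) • (ContinuousLinearMap.id ℝ E + k • A) := by
      rw [smul_add, smul_smul, div_mul_cancel₀ _ hk.ne', sub_smul, one_smul]; abel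
    have hq : h / k ≤ 1 := (div_le_one hk).2 hhk
    have hq0 : 0 ≤ h / k := by positivity
    have n : ‖ContinuousLinearMap.id ℝ E + h • A‖
        ≤ (1 - h / k) + (h / k) * ‖ContinuousLinearMap.id ℝ E + k • A‖ := by
      refine (congrArg norm e).le.trans ((norm_add_le _ _).trans ?_)
      rw [norm_smul, norm_smul, h1, Real.norm_of_nonneg hq0,
        Real.norm_of_nonneg (sub_nonneg.2 hq), mul_one]
    show (_ - 1) / h ≤ (_ - 1) / k
    rw [div_le_iff₀ hh]
    calc _ ≤ (1 - h / k) + (h / k) * ‖ContinuousLinearMap.id ℝ E + k • A‖ - 1 := by linarith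
      _ = _ := by ring
  have hbdd : BddBelow ((fun h : ℝ => (‖ContinuousLinearMap.id ℝ E + h • A‖ - 1) / h) ''
      Ioi 0) := by
    refine ⟨-‖A‖, ?_⟩
    rintro _ ⟨h, hh, rfl⟩
    simp only [mem_Ioi] at hh
    have n := norm_sub_le (ContinuousLinearMap.id ℝ E + h • A) (h • A)
    rw [add_sub_cancel_right, h1, norm_smul, Real.norm_of_nonneg hh.le] at n
    show _ ≤ (_ - 1) / h
    rw [le_div_iff₀ hh]
    linarith
  exact tendsto_nhds_limUnder ⟨_, hmono.tendsto_nhdsGT hbdd⟩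

/-- The upper right Dini derivative `D⁺g(t) = limsup_{h → 0+} (g(t + h) - g(t)) / h`, with values
in the extended reals. -/
noncomputable def diniUpperRight (g : ℝ → ℝ) (t : ℝ) : EReal :=
  limsup (fun h : ℝ => (((g (t + h) - g t) / h : ℝ) : EReal)) (𝓝[>] 0)

/-- The curve `x`, restricted to the interval `I` with left end point `t₀`, is a solution of the
initial value problem `ẋ = f(t, x)`, `x(t₀) = x₀`; that is, `x t = φ(t, t₀, x₀)` for `t ∈ I`.
At end points of `I` that belong to `I` the derivative is one-sided. -/
structure IsSolutionOn {E : Type*} [NormedAddCommGroup E] [NormedSpace ℝ E] (f : ℝ → E → E)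
    (t₀ : ℝ) (x₀ : E) (I : Set ℝ) (x : ℝ → E) : Prop where
  init : x t₀ = x₀
  deriv : ∀ t ∈ I, HasDerivWithinAt x (f t (x t)) I t

/-- `C` is forward invariant: solutions that start in `C` at a time `t₀ ≥ 0` remain in `C` for as
long as they exist. -/
def IsForwardInvariantSet {E : Type*} [NormedAddCommGroup E] [NormedSpace ℝ E] (f : ℝ → E → E)
    (C : Set E) : Prop :=
  ∀ (t₀ T : ℝ) (x₀ : E) (x : ℝ → E), 0 ≤ t₀ → x₀ ∈ C → IsSolutionOn f t₀ x₀ (Icc t₀ T) x →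
    ∀ t ∈ Icc t₀ T, x t ∈ C

end ContractionTheory

namespace ContractionTheory

section Pairing

variable {E : Type*} [NormedAddCommGroup E] [NormedSpace ℝ E] {W : E → E → ℝ}

theorem IsWeakPairing.le_norm_mul_norm (hW : IsWeakPairing W) (hWnorm : IsCompatiblePairing W)
    (x y : E) : W x y ≤ ‖x‖ * ‖y‖ := by
  have h := hW.cauchy_schwarz x y
  rwa [hWnorm, hWnorm, ← mul_pow, Real.sqrt_sq (by positivity)] at h

theorem IsWeakPairing.sub_le (hW : IsWeakPairing W) (hWnorm : IsCompatiblePairing W)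
    (x₁ x₂ y : E) : W x₁ y - W x₂ y ≤ ‖x₁ - x₂‖ * ‖y‖ := by
  have h := hW.subadd (x₁ - x₂) x₂ y
  rw [sub_add_cancel] at h
  linarith [hW.le_norm_mul_norm hWnorm (x₁ - x₂) y]

theorem IsWeakPairing.continuous_left (hW : IsWeakPairing W) (hWnorm : IsCompatiblePairing W)
    (y : E) : Continuous fun x => W x y := by
  refine (LipschitzWith.of_dist_le_mul (K := ‖y‖₊) fun x₁ x₂ => ?_).continuous
  rw [Real.dist_eq, dist_eq_norm, coe_nnnorm, mul_comm, abs_le]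
  have h₁ := hW.sub_le hWnorm x₁ x₂ y
  have h₂ := hW.sub_le hWnorm x₂ x₁ y
  rw [norm_sub_rev] at h₂
  constructor <;> linarith

/-- Deimling's inequality, in terms of difference quotients of the norm. -/
theorem IsRegularPairing.mul_le_norm_mul_sub (hW : IsRegularPairing W)
    (hWnorm : IsCompatiblePairing W) {h : ℝ} (hh : 0 ≤ h) (u z : E) :
    h * W u z ≤ ‖z‖ * (‖z + h • u‖ - ‖z‖) := by
  have h₁ := hW.subadd (z + h • u) (-z) z
  rw [add_neg_cancel_comm, hW.smul_left _ _ _ hh, hW.straight_angle, hWnorm] at h₁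
  have h₂ := hW.le_norm_mul_norm hWnorm (z + h • u) z
  linarith

theorem IsWeakPairing.mul_norm_le_norm_sub_smul (hW : IsWeakPairing W)
    (hWnorm : IsCompatiblePairing W) {A : E →L[ℝ] E} {b h : ℝ} (hh : 0 ≤ h)
    (hA : ∀ v, W (A v) v ≤ b * ‖v‖ ^ 2) (v : E) : (1 - h * b) * ‖v‖ ≤ ‖v - h • A v‖ := by
  rcases (norm_nonneg v).eq_or_lt with hv | hv
  · rw [← hv, mul_zero]; positivity
  refine le_of_mul_le_mul_right ?_ hv
  have h₁ := hW.subadd (v - h • A v) (h • A v) v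
  rw [sub_add_cancel, hW.smul_left _ _ _ hh, hWnorm] at h₁
  have h₂ := hW.le_norm_mul_norm hWnorm (v - h • A v) v
  have h₃ := mul_le_mul_of_nonneg_left (hA v) hh
  linarith

theorem IsWeakPairing.norm_id_add_smul_le (hW : IsWeakPairing W)
    (hWnorm : IsCompatiblePairing W) {A : E →L[ℝ] E} {b h M : ℝ} (hh : 0 ≤ h) (hb : h * b < 1)
    (hM : ‖A‖ ≤ M) (hA : ∀ v, W (A v) v ≤ b * ‖v‖ ^ 2) :
    ‖ContinuousLinearMap.id ℝ E + h • A‖ ≤ (1 + h ^ 2 * M ^ 2) / (1 - h * b) := by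
  have hb' : 0 < 1 - h * b := sub_pos.2 hb
  refine ContinuousLinearMap.opNorm_le_bound _ (by positivity) fun u => ?_
  rw [div_mul_eq_mul_div, le_div_iff₀' hb']
  refine (hW.mul_norm_le_norm_sub_smul hWnorm hh hA _).trans ?_
  have e : (ContinuousLinearMap.id ℝ E + h • A) u
      - h • A ((ContinuousLinearMap.id ℝ E + h • A) u) = u - (h ^ 2) • A (A u) := by
    simp only [add_apply, ContinuousLinearMap.id_apply,
      smul_apply, map_add, map_smul, smul_add, smul_smul, pow_two]
    abel
  have hM0 : 0 ≤ M := (norm_nonneg A).trans hM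
  have hAA : ‖A (A u)‖ ≤ M ^ 2 * ‖u‖ := by
    rw [pow_two, mul_assoc]
    exact A.le_of_opNorm_le_of_le hM (A.le_of_opNorm_le hM u)
  rw [e]
  refine (norm_sub_le _ _).trans ?_
  rw [norm_smul, Real.norm_of_nonneg (sq_nonneg h)]
  nlinarith [mul_le_mul_of_nonneg_left hAA (sq_nonneg h)]

theorem eventually_mul_lt_one (b : ℝ) : ∀ᶠ h : ℝ in 𝓝[>] 0, h * b < 1 :=
  nhdsWithin_le_nhds ((by fun_prop : Continuous fun h : ℝ => h * b).continuousAt.eventually_lt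
    continuousAt_const (by simp))

theorem tendsto_one_add_sq_div_sub_one_div (b M : ℝ) :
    Tendsto (fun h : ℝ => ((1 + h ^ 2 * M ^ 2) / (1 - h * b) - 1) / h) (𝓝[>] 0) (𝓝 b) := by
  have h₁ : Tendsto (fun h : ℝ => (b + h * M ^ 2) / (1 - h * b)) (𝓝[>] 0) (𝓝 b) := by
    have : ContinuousAt (fun h : ℝ => (b + h * M ^ 2) / (1 - h * b)) 0 :=
      ContinuousAt.div (by fun_prop) (by fun_prop) (by simp)
    simpa using this.tendsto.mono_left nhdsWithin_le_nhds
  refine h₁.congr' ?_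
  filter_upwards [eventually_mul_lt_one b, self_mem_nhdsWithin] with h hb hh
  have hh' : h ≠ 0 := (mem_Ioi.1 hh).ne'
  have hb' : 1 - h * b ≠ 0 := (sub_pos.2 hb).ne'
  rw [div_sub_one hb', div_div, div_eq_div_iff hb' (mul_ne_zero hb' hh')]
  ring

theorem IsWeakPairing.logNorm_le [Nontrivial E] (hW : IsWeakPairing W)
    (hWnorm : IsCompatiblePairing W) {A : E →L[ℝ] E} {b : ℝ}
    (hA : ∀ v, W (A v) v ≤ b * ‖v‖ ^ 2) : logNorm A ≤ b := by
  refine le_of_tendsto_of_tendsto (tendsto_logNorm A)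
    (tendsto_one_add_sq_div_sub_one_div b ‖A‖) ?_
  filter_upwards [eventually_mul_lt_one b, self_mem_nhdsWithin] with h hb hh
  have hh' : 0 < h := hh
  have := hW.norm_id_add_smul_le hWnorm hh'.le hb le_rfl hA
  gcongr

theorem IsRegularPairing.apply_le_logNorm_mul [Nontrivial E] (hW : IsRegularPairing W)
    (hWnorm : IsCompatiblePairing W) (A : E →L[ℝ] E) (v : E) :
    W (A v) v ≤ logNorm A * ‖v‖ ^ 2 := by
  refine ge_of_tendsto ((tendsto_logNorm A).mul_const (‖v‖ ^ 2)) ?_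
  filter_upwards [self_mem_nhdsWithin] with h hh
  have hh' : 0 < h := hh
  have h₁ := hW.mul_le_norm_mul_sub hWnorm hh'.le (A v) v
  have h₂ := (ContinuousLinearMap.id ℝ E + h • A).le_opNorm v
  simp only [add_apply, ContinuousLinearMap.id_apply,
    smul_apply] at h₂
  rw [div_mul_eq_mul_div, le_div_iff₀ hh']
  nlinarith [mul_le_mul_of_nonneg_left h₂ (norm_nonneg v)]

/-- A bound on the pairing with the derivative of a vector field makes its explicit Euler steps
contracting, up to second order in the step size. -/
theorem IsWeakPairing.exists_norm_sub_add_smul_sub_le (hW : IsWeakPairing W)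
    (hWnorm : IsCompatiblePairing W) {g : E → E} {C : Set E} (hCopen : IsOpen C)
    (hCconvex : Convex ℝ C) (hg : ContDiffOn ℝ 1 g C) {b : ℝ}
    (hb : ∀ x ∈ C, ∀ v, W (fderiv ℝ g x v) v ≤ b * ‖v‖ ^ 2) {x y : E} (hx : x ∈ C) (hy : y ∈ C) :
    ∃ M : ℝ, ∀ h : ℝ, 0 ≤ h → h * b < 1 →
      ‖x - y + h • (g x - g y)‖ ≤ (1 + h ^ 2 * M ^ 2) / (1 - h * b) * ‖x - y‖ := by
  have hsub : segment ℝ y x ⊆ C := hCconvex.segment_subset hy hx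
  have hcomp : IsCompact (segment ℝ y x) := by
    rw [segment_eq_image_lineMap]
    exact isCompact_Icc.image AffineMap.lineMap_continuous
  obtain ⟨M, hM⟩ := hcomp.exists_bound_of_continuousOn
    ((hg.continuousOn_fderiv_of_isOpen hCopen le_rfl).mono hsub)
  refine ⟨M, fun h hh hhb => ?_⟩
  have hderiv : ∀ w ∈ segment ℝ y x, HasFDerivWithinAt (fun w => w + h • g w)
      (ContinuousLinearMap.id ℝ E + h • fderiv ℝ g w) (segment ℝ y x) w := fun w hw =>
    ((hasFDerivAt_id w).add (((hg.contDiffAt (hCopen.mem_nhds (hsub hw))).differentiableAt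
      one_ne_zero).hasFDerivAt.const_smul h)).hasFDerivWithinAt
  have := (convex_segment y x).norm_image_sub_le_of_norm_hasFDerivWithin_le hderiv
    (fun w hw => hW.norm_id_add_smul_le hWnorm hh hhb (hM w hw) (hb w (hsub hw)))
    (left_mem_segment ℝ y x) (right_mem_segment ℝ y x)
  convert this using 2
  rw [smul_sub]; abel

theorem IsWeakPairing.fderiv_apply_le (hW : IsWeakPairing W) (hWnorm : IsCompatiblePairing W)
    {g : E → E} {C : Set E} {b : ℝ} {x : E} (hC : C ∈ 𝓝 x) (hg : DifferentiableAt ℝ g x)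
    (hb : ∀ y ∈ C, W (g y - g x) (y - x) ≤ b * ‖y - x‖ ^ 2) (v : E) :
    W (fderiv ℝ g x v) v ≤ b * ‖v‖ ^ 2 := by
  have hlim := (hasDerivWithinAt_iff_tendsto_slope' self_notMem_Ioi).1
    (hg.hasFDerivAt.hasLineDerivAt v).hasDerivWithinAt
  refine le_of_tendsto (((hW.continuous_left hWnorm v).tendsto _).comp hlim) ?_
  have hmem : ∀ᶠ h : ℝ in 𝓝[>] 0, x + h • v ∈ C := nhdsWithin_le_nhds
    ((by fun_prop : Continuous fun h : ℝ => x + h • v).continuousAt.eventually_mem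
      (by simpa using hC))
  filter_upwards [hmem, self_mem_nhdsWithin] with h hh hpos
  have hpos' : 0 < h := hpos
  have h₁ := hb _ hh
  rw [add_sub_cancel_left, hW.smul_right _ _ _ hpos'.le, norm_smul, Real.norm_of_nonneg hpos'.le]
    at h₁
  simp only [Function.comp_apply, slope, zero_smul, add_zero, sub_zero, vsub_eq_sub]
  rw [hW.smul_left _ _ _ (inv_nonneg.2 hpos'.le), inv_mul_le_iff₀ hpos']
  refine le_of_mul_le_mul_left (h₁.trans_eq ?_) hpos'
  ring

end Pairing

end ContractionTheory

namespace ContractionTheory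

variable {E : Type*} [NormedAddCommGroup E] [NormedSpace ℝ E]

theorem tendsto_norm_sub_norm_div_of_hasDerivWithinAt {z : ℝ → E} {u : E} {t : ℝ}
    (hz : HasDerivWithinAt z u (Ioi t) t) :
    Tendsto (fun h : ℝ => (‖z (t + h)‖ - ‖z t + h • u‖) / h) (𝓝[>] 0) (𝓝 0) := by
  have hadd : Tendsto (fun h : ℝ => t + h) (𝓝[>] 0) (𝓝[>] t) := by
    refine tendsto_nhdsWithin_iff.2 ⟨?_, ?_⟩
    · have : Continuous fun h : ℝ => t + h := by fun_prop
      simpa using (this.tendsto 0).mono_left nhdsWithin_le_nhds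
    · filter_upwards [self_mem_nhdsWithin] with h hh
      simpa using hh
  have h₁ := ((hasDerivWithinAt_iff_tendsto_slope' self_notMem_Ioi).1 hz).comp hadd
  have h₂ := tendsto_iff_norm_sub_tendsto_zero.1 h₁
  refine squeeze_zero_norm' ?_ h₂
  filter_upwards [self_mem_nhdsWithin] with h hh
  have hh' : 0 < h := hh
  rw [norm_div, Real.norm_of_nonneg hh'.le, div_le_iff₀ hh']
  refine (abs_norm_sub_norm_le _ _).trans_eq ?_
  have e : z (t + h) - (z t + h • u) = h • ((slope z t ∘ fun h => t + h) h - u) := by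
    simp only [Function.comp_apply, slope, add_sub_cancel_left, vsub_eq_sub, smul_sub,
      smul_inv_smul₀ hh'.ne']
    abel
  rw [e, norm_smul, Real.norm_of_nonneg hh'.le, mul_comm]

theorem diniUpperRight_le_of_tendsto {g ψ : ℝ → ℝ} {t c : ℝ}
    (hle : ∀ᶠ h in 𝓝[>] 0, (g (t + h) - g t) / h ≤ ψ h) (hψ : Tendsto ψ (𝓝[>] 0) (𝓝 c)) :
    diniUpperRight g t ≤ (c : EReal) := by
  have hψ' : Tendsto (fun h => (ψ h : EReal)) (𝓝[>] 0) (𝓝 (c : EReal)) :=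
    (continuous_coe_real_ereal.tendsto c).comp hψ
  rw [← hψ'.limsup_eq]
  exact limsup_le_limsup (hle.mono fun h hh => EReal.coe_le_coe_iff.2 hh)

/-- Grönwall's inequality for the upper right Dini derivative. -/
theorem le_exp_mul_of_diniUpperRight_le {g : ℝ → ℝ} {b s t : ℝ} (hst : s ≤ t)
    (hg : ContinuousOn g (Icc s t))
    (hD : ∀ τ ∈ Ico s t, diniUpperRight g τ ≤ ((b * g τ : ℝ) : EReal)) :
    g t ≤ Real.exp (b * (t - s)) * g s := by
  have := le_gronwallBound_of_liminf_deriv_right_le (f' := fun τ => b * g τ) (K := b) (ε := 0)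
    hg ?_ (le_refl (g s)) (fun τ _ => by simp) t (right_mem_Icc.2 hst)
  · rwa [gronwallBound_ε0, mul_comm] at this
  intro τ hτ r hr
  have hev := eventually_lt_of_limsup_lt ((hD τ hτ).trans_lt (EReal.coe_lt_coe_iff.2 hr))
  have hsub : Tendsto (fun z : ℝ => z - τ) (𝓝[>] τ) (𝓝[>] 0) := by
    refine tendsto_nhdsWithin_iff.2 ⟨?_, ?_⟩
    · have : Continuous fun z : ℝ => z - τ := by fun_prop
      simpa using (this.tendsto τ).mono_left nhdsWithin_le_nhds
    · filter_upwards [self_mem_nhdsWithin] with z hz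
      simpa using hz
  refine ((hsub.eventually hev).mono fun z hz => ?_).frequently
  rw [EReal.coe_lt_coe_iff, add_sub_cancel] at hz
  rwa [inv_mul_eq_div]

theorem IsSolutionOn.mono {f : ℝ → E → E} {t₀ : ℝ} {x₀ : E} {I J : Set ℝ} {x : ℝ → E}
    (h : IsSolutionOn f t₀ x₀ I x) (hJ : J ⊆ I) : IsSolutionOn f t₀ x₀ J x :=
  ⟨h.init, fun t ht => (h.deriv t (hJ ht)).mono hJ⟩

theorem IsSolutionOn.hasDerivWithinAt_Ioi {f : ℝ → E → E} {t₀ t T : ℝ} {x₀ : E} {x : ℝ → E}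
    (h : IsSolutionOn f t₀ x₀ (Ico t₀ T) x) (ht : t ∈ Ico t₀ T) :
    HasDerivWithinAt x (f t (x t)) (Ioi t) t :=
  (h.deriv t ht).mono_of_mem_nhdsWithin (mem_of_superset (Ioo_mem_nhdsGT ht.2)
    fun _ hτ => ⟨ht.1.trans hτ.1.le, hτ.2⟩)

theorem IsSolutionOn.continuousOn {f : ℝ → E → E} {t₀ : ℝ} {x₀ : E} {I : Set ℝ} {x : ℝ → E}
    (h : IsSolutionOn f t₀ x₀ I x) : ContinuousOn x I :=
  fun t ht => (h.deriv t ht).continuousWithinAt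

theorem IsForwardInvariantSet.mem {f : ℝ → E → E} {C : Set E} (hC : IsForwardInvariantSet f C)
    {t₀ t T : ℝ} {x₀ : E} {x : ℝ → E} (ht₀ : 0 ≤ t₀) (hx₀ : x₀ ∈ C)
    (h : IsSolutionOn f t₀ x₀ (Ico t₀ T) x) (ht : t ∈ Ico t₀ T) : x t ∈ C :=
  hC t₀ t x₀ x ht₀ hx₀ (h.mono (Icc_subset_Ico_right ht.2)) t (right_mem_Icc.2 ht.1)

/-- A vector field that is uniformly Lipschitz near `x₀` and continuous in time has a local
solution through `(t₀, x₀)`. -/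
theorem exists_isSolutionOn_of_lipschitzOnWith [CompleteSpace E] {f : ℝ → E → E} {t₀ δ r : ℝ}
    {x₀ : E} {K : NNReal} (hδ : 0 < δ) (hr : 0 < r)
    (hlip : ∀ t ∈ Icc t₀ (t₀ + δ), LipschitzOnWith K (f t) (Metric.closedBall x₀ r))
    (hcont : ∀ x ∈ Metric.closedBall x₀ r, ContinuousOn (fun t => f t x) (Icc t₀ (t₀ + δ))) :
    ∃ ε > 0, ∃ x : ℝ → E, IsSolutionOn f t₀ x₀ (Icc t₀ (t₀ + ε)) x := by
  obtain ⟨B, hB⟩ := isCompact_Icc.exists_bound_of_continuousOn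
    (hcont x₀ (Metric.mem_closedBall_self hr.le))
  have hB0 : 0 ≤ B := (norm_nonneg _).trans (hB t₀ (left_mem_Icc.2 (by linarith)))
  set L : ℝ := B + K * r + 1 with hL
  have hL0 : 0 < L := by positivity
  set ε := min δ (r / L) with hε
  have hε0 : 0 < ε := lt_min hδ (by positivity)
  have hsub : Icc t₀ (t₀ + ε) ⊆ Icc t₀ (t₀ + δ) :=
    Icc_subset_Icc_right (by linarith [min_le_left δ (r / L)])
  have hPL : IsPicardLindelof f (⟨t₀, left_mem_Icc.2 (by linarith)⟩ : Icc t₀ (t₀ + ε)) x₀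
      ⟨r, hr.le⟩ 0 ⟨L, hL0.le⟩ K := by
    refine ⟨fun t ht => hlip t (hsub ht), fun x hx => (hcont x hx).mono hsub,
      fun t ht x hx => ?_, ?_⟩
    · have h₁ := (hlip t (hsub ht)).dist_le_mul x hx x₀ (Metric.mem_closedBall_self hr.le)
      rw [dist_eq_norm] at h₁
      have h₂ : (K : ℝ) * dist x x₀ ≤ K * r :=
        mul_le_mul_of_nonneg_left (Metric.mem_closedBall.1 hx) K.2
      have h₃ := norm_le_norm_add_norm_sub' (f t x) (f t x₀)
      change ‖f t x‖ ≤ L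
      linarith [hB t (hsub ht)]
    · change L * max (t₀ + ε - t₀) (t₀ - t₀) ≤ r - 0
      rw [add_sub_cancel_left, sub_self, max_eq_left hε0.le, sub_zero, mul_comm,
        ← le_div_iff₀ hL0]
      exact min_le_right _ _
  obtain ⟨x, hx₀, hx⟩ := hPL.exists_eq_forall_mem_Icc_hasDerivWithinAt₀
  exact ⟨ε, hε0, x, hx₀, hx⟩

/-- A vector field that is continuous in time and, at every time, Lipschitz on `s`, is uniformly
Lipschitz on `s` near each time in an open dense set. -/
theorem isOpen_and_dense_setOf_eventually_lipschitzOnWith {X Y F : Type*} [TopologicalSpace X]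
    [BaireSpace X] [PseudoMetricSpace Y] [PseudoMetricSpace F] {g : X → Y → F}
    {s : Set Y} (hg : ∀ y ∈ s, Continuous fun τ => g τ y)
    (hlip : ∀ τ, ∃ K : NNReal, LipschitzOnWith K (g τ) s) :
    IsOpen {τ | ∃ K : NNReal, ∀ᶠ σ in 𝓝 τ, LipschitzOnWith K (g σ) s} ∧
      Dense {τ | ∃ K : NNReal, ∀ᶠ σ in 𝓝 τ, LipschitzOnWith K (g σ) s} := by
  constructor
  · refine isOpen_iff_mem_nhds.2 fun τ ⟨K, hK⟩ => ?_
    filter_upwards [eventually_eventually_nhds.2 hK] with σ hσ using ⟨K, hσ⟩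
  · have hclosed : ∀ n : ℕ, IsClosed {τ | LipschitzOnWith (n : NNReal) (g τ) s} := fun n => by
      simp only [lipschitzOnWith_iff_dist_le_mul, ofPred_forall]
      exact isClosed_biInter fun y hy => isClosed_biInter fun y' hy' =>
        isClosed_le ((hg y hy).dist (hg y' hy')) continuous_const
    refine (dense_iUnion_interior_of_closed hclosed (eq_univ_of_forall fun τ => ?_)).mono ?_
    · obtain ⟨K, hK⟩ := hlip τ
      obtain ⟨n, hn⟩ := exists_nat_ge K
      exact mem_iUnion.2 ⟨n, hK.weaken hn⟩
    · exact iUnion_subset fun n τ hτ => ⟨n, mem_interior_iff_mem_nhds.1 hτ⟩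

/-- A vector field which is `C¹` in space and separately continuous in time has local solutions
starting from a given point at an open dense set of initial times. -/
theorem exists_dense_forall_exists_isSolutionOn [FiniteDimensional ℝ E] {f : ℝ → E → E}
    {C : Set E} (hCopen : IsOpen C) (hfx : ∀ t, 0 ≤ t → ContDiffOn ℝ 1 (f t) C)
    (hft : ∀ x ∈ C, ContinuousOn (fun t => f t x) (Ici 0)) {x₀ : E} (hx₀ : x₀ ∈ C) :
    ∃ U : Set ℝ, IsOpen U ∧ Dense U ∧ ∀ t ∈ U, 0 ≤ t →
      ∃ ε > 0, ∃ x : ℝ → E, IsSolutionOn f t x₀ (Icc t (t + ε)) x := by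
  obtain ⟨r, hr, hrC⟩ := Metric.nhds_basis_closedBall.mem_iff.1 (hCopen.mem_nhds hx₀)
  have := FiniteDimensional.proper_real E
  have hmax : ∀ y ∈ Metric.closedBall x₀ r, Continuous fun τ : ℝ => f (max τ 0) y := fun y hy =>
    (hft y (hrC hy)).comp_continuous (by fun_prop) fun τ => le_max_right τ 0
  have hlip : ∀ τ : ℝ, ∃ K, LipschitzOnWith K (f (max τ 0)) (Metric.closedBall x₀ r) := fun τ =>
    ((hfx _ (le_max_right τ 0)).mono hrC).exists_lipschitzOnWith one_ne_zero
      (convex_closedBall x₀ r) (isCompact_closedBall x₀ r)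
  obtain ⟨hU, hdense⟩ := isOpen_and_dense_setOf_eventually_lipschitzOnWith hmax hlip
  refine ⟨_, hU, hdense, fun t ⟨K, hK⟩ ht => ?_⟩
  obtain ⟨δ, hδ, hball⟩ := Metric.nhds_basis_closedBall.mem_iff.1 hK
  refine exists_isSolutionOn_of_lipschitzOnWith hδ hr (K := K) (fun τ hτ => ?_) fun y hy =>
    (hft y (hrC hy)).mono fun τ hτ => ht.trans hτ.1
  have := hball (Metric.mem_closedBall.2 (Real.dist_eq τ t ▸ abs_le.2
    ⟨by linarith [hτ.1], by linarith [hτ.2]⟩))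
  rwa [mem_ofPred_eq, max_eq_left (ht.trans hτ.1)] at this

section Contraction

variable {W : E → E → ℝ} {f : ℝ → E → E} {C : Set E} {b : ℝ}

theorem IsWeakPairing.diniUpperRight_norm_sub_le (hW : IsWeakPairing W)
    (hWnorm : IsCompatiblePairing W) (hCopen : IsOpen C) (hCconvex : Convex ℝ C) {t : ℝ}
    (hf : ContDiffOn ℝ 1 (f t) C)
    (hb : ∀ x ∈ C, ∀ v, W (fderiv ℝ (f t) x v) v ≤ b * ‖v‖ ^ 2) {x y : ℝ → E}
    (hx : x t ∈ C) (hy : y t ∈ C) (hx' : HasDerivWithinAt x (f t (x t)) (Ioi t) t)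
    (hy' : HasDerivWithinAt y (f t (y t)) (Ioi t) t) :
    diniUpperRight (fun τ => ‖x τ - y τ‖) t ≤ ((b * ‖x t - y t‖ : ℝ) : EReal) := by
  obtain ⟨M, hM⟩ := hW.exists_norm_sub_add_smul_sub_le hWnorm hCopen hCconvex hf hb hx hy
  have hlim := (tendsto_norm_sub_norm_div_of_hasDerivWithinAt (hx'.sub hy')).add
    ((tendsto_one_add_sq_div_sub_one_div b M).mul_const ‖x t - y t‖)
  rw [zero_add] at hlim
  refine diniUpperRight_le_of_tendsto ?_ hlim
  filter_upwards [eventually_mul_lt_one b, self_mem_nhdsWithin] with h hhb hh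
  have hh' : 0 < h := hh
  rw [div_mul_eq_mul_div, ← add_div]
  refine div_le_div_of_nonneg_right ?_ hh'.le
  have := hM h hh'.le hhb
  simp only [Pi.sub_apply]
  linarith

theorem IsRegularPairing.apply_le_of_norm_sub_le (hW : IsRegularPairing W)
    (hWnorm : IsCompatiblePairing W) {z : ℝ → E} {u : E} {t : ℝ}
    (hz : HasDerivWithinAt z u (Ioi t) t)
    (hb : ∀ᶠ h in 𝓝[>] 0, ‖z (t + h)‖ ≤ Real.exp (b * h) * ‖z t‖) :
    W u (z t) ≤ b * ‖z t‖ ^ 2 := by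
  have hexp : Tendsto (fun h : ℝ => (Real.exp (b * h) - 1) / h) (𝓝[>] 0) (𝓝 b) := by
    have h₁ : HasDerivAt (fun h : ℝ => Real.exp (b * h)) b 0 := by
      simpa using ((hasDerivAt_id (0 : ℝ)).const_mul b).exp
    have := (hasDerivWithinAt_iff_tendsto_slope' self_notMem_Ioi).1
      (h₁.hasDerivWithinAt (s := Ioi 0))
    simpa [slope_fun_def_field] using this
  have hlim := ((hexp.mul_const ‖z t‖).sub
    (tendsto_norm_sub_norm_div_of_hasDerivWithinAt hz)).const_mul ‖z t‖
  rw [sub_zero, show ‖z t‖ * (b * ‖z t‖) = b * ‖z t‖ ^ 2 by ring] at hlim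
  refine ge_of_tendsto hlim ?_
  filter_upwards [hb, self_mem_nhdsWithin] with h hhb hh
  have hh' : 0 < h := hh
  rw [div_mul_eq_mul_div, ← sub_div, ← mul_div_assoc, le_div_iff₀ hh', mul_comm]
  refine (hW.mul_le_norm_mul_sub hWnorm hh'.le u (z t)).trans
    (mul_le_mul_of_nonneg_left ?_ (norm_nonneg _))
  linarith

theorem IsRegularPairing.apply_sub_le_of_contracting [FiniteDimensional ℝ E]
    (hW : IsRegularPairing W) (hWnorm : IsCompatiblePairing W) (hCopen : IsOpen C)
    (hfx : ∀ t, 0 ≤ t → ContDiffOn ℝ 1 (f t) C)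
    (hft : ∀ x ∈ C, ContinuousOn (fun t => f t x) (Ici 0)) {x₀ y₀ : E} (hx₀ : x₀ ∈ C)
    (hy₀ : y₀ ∈ C)
    (hb : ∀ t₀ t : ℝ, 0 ≤ t₀ → t₀ ≤ t → ∀ x y : ℝ → E, IsSolutionOn f t₀ x₀ (Icc t₀ t) x →
      IsSolutionOn f t₀ y₀ (Icc t₀ t) y → ‖x t - y t‖ ≤ Real.exp (b * (t - t₀)) * ‖x₀ - y₀‖)
    {t : ℝ} (ht : 0 ≤ t) : W (f t x₀ - f t y₀) (x₀ - y₀) ≤ b * ‖x₀ - y₀‖ ^ 2 := by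
  obtain ⟨U, hU, hUd, hUx⟩ := exists_dense_forall_exists_isSolutionOn hCopen hfx hft hx₀
  obtain ⟨V, hV, hVd, hVy⟩ := exists_dense_forall_exists_isSolutionOn hCopen hfx hft hy₀
  have hdense : Ici (0 : ℝ) ⊆ closure (Ioi 0 ∩ (U ∩ V)) := by
    rw [← closure_Ioi]
    exact closure_minimal ((hUd.inter_of_isOpen_left hVd hU).open_subset_closure_inter isOpen_Ioi)
      isClosed_closure
  have hsub : Ioi (0 : ℝ) ∩ (U ∩ V) ⊆ Ici 0 := fun τ hτ => mem_Ici.2 (mem_Ioi.1 hτ.1).le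
  have hcont : ContinuousOn (fun τ => W (f τ x₀ - f τ y₀) (x₀ - y₀)) (Ici 0) :=
    (hW.continuous_left hWnorm (x₀ - y₀)).comp_continuousOn ((hft x₀ hx₀).sub (hft y₀ hy₀))
  have key : ∀ τ ∈ Ioi (0 : ℝ) ∩ (U ∩ V),
      W (f τ x₀ - f τ y₀) (x₀ - y₀) ≤ b * ‖x₀ - y₀‖ ^ 2 := by
    rintro τ ⟨hτ, hτU, hτV⟩
    obtain ⟨ε₁, hε₁, x, hx⟩ := hUx τ hτU hτ.le
    obtain ⟨ε₂, hε₂, y, hy⟩ := hVy τ hτV hτ.le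
    have hderiv := ((hx.mono Ico_subset_Icc_self).hasDerivWithinAt_Ioi
      (left_mem_Ico.2 (by linarith))).sub
      ((hy.mono Ico_subset_Icc_self).hasDerivWithinAt_Ioi (left_mem_Ico.2 (by linarith)))
    have := hW.apply_le_of_norm_sub_le hWnorm (b := b) hderiv ?_
    · simpa only [Pi.sub_apply, hx.init, hy.init] using this
    filter_upwards [Ioo_mem_nhdsGT (lt_min hε₁ hε₂)] with h hh
    have := hb τ (τ + h) hτ.le (by linarith [hh.1]) x y
      (hx.mono (Icc_subset_Icc_right (by linarith [hh.2, min_le_left ε₁ ε₂])))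
      (hy.mono (Icc_subset_Icc_right (by linarith [hh.2, min_le_right ε₁ ε₂])))
    simpa only [Pi.sub_apply, hx.init, hy.init, add_sub_cancel_left] using this
  have hmem := mem_closure_iff_nhdsWithin_neBot.1 (hdense ht)
  exact le_of_tendsto ((hcont t ht).mono_left (nhdsWithin_mono t hsub))
    (eventually_mem_nhdsWithin.mono key)

end Contraction

end ContractionTheory

theorem theorem4p1 {E : Type*} [NormedAddCommGroup E] [NormedSpace ℝ E] [FiniteDimensional ℝ E]
    [Nontrivial E] (W : E → E → ℝ) (hW : ContractionTheory.IsRegularPairing W)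
    (hWnorm : ContractionTheory.IsCompatiblePairing W)
    (f : ℝ → E → E) (C : Set E) (hCopen : IsOpen C) (hCconvex : Convex ℝ C)
    (hfx : ∀ t, 0 ≤ t → ContDiffOn ℝ 1 (f t) C)
    (hft : ∀ x ∈ C, ContinuousOn (fun t => f t x) (Ici 0))
    (hCinv : ContractionTheory.IsForwardInvariantSet f C) (b : ℝ) :
    List.TFAE [
      ∀ x ∈ C, ∀ y ∈ C, ∀ t, 0 ≤ t → W (f t x - f t y) (x - y) ≤ b * ‖x - y‖ ^ 2,
      ∀ v : E, ∀ x ∈ C, ∀ t, 0 ≤ t → W (fderiv ℝ (f t) x v) v ≤ b * ‖v‖ ^ 2,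
      ∀ x ∈ C, ∀ t, 0 ≤ t → ContractionTheory.logNorm (fderiv ℝ (f t) x) ≤ b,
      ∀ x₀ ∈ C, ∀ y₀ ∈ C, ∀ t₀ t T : ℝ, 0 ≤ t₀ → t₀ ≤ t → t < T → ∀ x y : ℝ → E,
        ContractionTheory.IsSolutionOn f t₀ x₀ (Ico t₀ T) x →
        ContractionTheory.IsSolutionOn f t₀ y₀ (Ico t₀ T) y →
        ContractionTheory.diniUpperRight (fun τ => ‖x τ - y τ‖) t
          ≤ ((b * ‖x t - y t‖ : ℝ) : EReal),
      ∀ x₀ ∈ C, ∀ y₀ ∈ C, ∀ t₀ s t : ℝ, 0 ≤ t₀ → t₀ ≤ s → s ≤ t → ∀ x y : ℝ → E,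
        ContractionTheory.IsSolutionOn f t₀ x₀ (Icc t₀ t) x →
        ContractionTheory.IsSolutionOn f t₀ y₀ (Icc t₀ t) y →
        ‖x t - y t‖ ≤ Real.exp (b * (t - s)) * ‖x s - y s‖] := by
  have hdiff : ∀ t, 0 ≤ t → ∀ x ∈ C, DifferentiableAt ℝ (f t) x := fun t ht x hx =>
    ((hfx t ht).contDiffAt (hCopen.mem_nhds hx)).differentiableAt one_ne_zero
  tfae_have 1 → 2 := fun h v x hx t ht =>
    hW.fderiv_apply_le hWnorm (hCopen.mem_nhds hx) (hdiff t ht x hx)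
      (fun y hy => h y hy x hx t ht) v
  tfae_have 2 → 3 := fun h x hx t ht => hW.logNorm_le hWnorm fun v => h v x hx t ht
  tfae_have 3 → 2 := fun h v x hx t ht => (hW.apply_le_logNorm_mul hWnorm _ v).trans
    (mul_le_mul_of_nonneg_right (h x hx t ht) (sq_nonneg _))
  tfae_have 2 → 4 := by
    intro h x₀ hx₀ y₀ hy₀ t₀ t T ht₀ ht hT x y hx hy
    have ht0 : 0 ≤ t := ht₀.trans ht
    exact hW.diniUpperRight_norm_sub_le hWnorm hCopen hCconvex (hfx t ht0)
      (fun x hx v => h v x hx t ht0) (hCinv.mem ht₀ hx₀ hx ⟨ht, hT⟩)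
      (hCinv.mem ht₀ hy₀ hy ⟨ht, hT⟩) (hx.hasDerivWithinAt_Ioi ⟨ht, hT⟩)
      (hy.hasDerivWithinAt_Ioi ⟨ht, hT⟩)
  tfae_have 4 → 5 := by
    intro h x₀ hx₀ y₀ hy₀ t₀ s t ht₀ hs hst x y hx hy
    exact ContractionTheory.le_exp_mul_of_diniUpperRight_le (g := fun τ => ‖x τ - y τ‖) hst
      ((hx.continuousOn.sub hy.continuousOn).norm.mono (Icc_subset_Icc_left hs))
      fun τ hτ => h x₀ hx₀ y₀ hy₀ t₀ τ t ht₀ (hs.trans hτ.1) hτ.2 x y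
        (hx.mono Ico_subset_Icc_self) (hy.mono Ico_subset_Icc_self)
  tfae_have 5 → 1 := by
    intro h x₀ hx₀ y₀ hy₀ t ht
    refine hW.apply_sub_le_of_contracting hWnorm hCopen hfx hft hx₀ hy₀
      (fun t₀ t ht₀ htt x y hx hy => ?_) ht
    have := h x₀ hx₀ y₀ hy₀ t₀ t₀ t ht₀ le_rfl htt x y hx hy
    rwa [hx.init, hy.init] at this
  tfae_finish
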